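/- Let $\Delta_A$, $\Delta_B$ be nondegenerate real skew-symmetric matrices, regarded as symplectic forms on the coordinate spaces $Z_A$, $Z_B$ (finite-dimensional real coordinate spaces), and let $W_A$, $W_B$ be irreducible, strongly continuous Weyl systems of unitary operators on nonzero complex Hilbert spaces $\mathcal H_A$, $\mathcal H_B$, i.e. for $X\in\{A,B\}$ $$W_X(z)W_X(z')=\exp\left(-\tfrac i2 z^\top\Delta_X z'\right)W_X(z'+z),\qquad z,z'\in Z_X .$$ A channel $\Phi:\mathfrak T(\mathcal H_A)\to\mathfrak T(\mathcal H_B)$ is a linear completely positive trace-preserving map between the spaces of trace-class operators; its dual $\Phi^*:\mathfrak B(\mathcal H_B)\to\mathfrak B(\mathcal H_A)$ is determined by $\mathrm{Tr}\,A\,\Phi[\rho]=\mathrm{Tr}\,\Phi^*[A]\rho$. The channel is called classical-quantum (c-q) if the operators $\Phi^*[A]$, $A\in\mathfrak B(\mathcal H_B)$, all commute with each other; a c-q channel is called of discrete type if all these operators are diagonal in one fixed orthonormal basis of the input space. It is called completely depolarizing if $\Phi[\rho]=(\mathrm{Tr}\rho)\,\sigma$ for one fixed state $\sigma$. For a closed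 subspace $\mathcal H_0\subseteq\mathcal H_A$ with $\dim\mathcal H_0\ge 2$, the subchannel of $\Phi$ corresponding to $\mathcal H_0$ is the restriction of $\Phi$ to the trace-class operators on $\mathcal H_0$, regarded as a channel with input space $\mathcal H_0$. Let $K$ be a real matrix defining a linear operator $Z_B\to Z_A$, let $l\in Z_B$, let $\alpha$ be a real symmetric matrix with $\alpha\ge\pm\frac i2\left(\Delta_B-K^\top\Delta_A K\right)$, and let $\Phi_{K,l,\alpha}$ be the Bosonic Gaussian channel with these parameters, i.e. the channel with $$\Phi_{K,l,\alpha}^*[W_B(z)]=W_A(Kz)\exp\left[i\,l^\top z-\tfrac12 z^\top\alpha z\right],\qquad z\in Z_B .$$ 1) $\Phi_{K,l,\alpha}$ is c-q if and only if $K^\top\Delta_A K=0$. It is c-q of discrete type if and only if $K=0$, and $K=0$ holds if and only if $\Phi_{K,l,\alpha}$ is completely depolarizing. 2) If $\operatorname{rank}K=\dim Z_A$, then $\Phi_{K,l,\alpha}$ has no c-q subchannels of discrete type. -/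

import Mathlib

namespace QChannel

noncomputable section

open scoped InnerProductSpace ComplexOrder
open InnerProductSpace (rankOne)

section TraceClass

variable {H K : Type*} [NormedAddCommGroup H] [InnerProductSpace ℂ H]
  [NormedAddCommGroup K] [InnerProductSpace ℂ K]

/-- `T = ∑ₙ |xₙ⟩⟨yₙ|` in operator norm, with `∑ₙ ‖xₙ‖ ‖yₙ‖ < ∞`. -/
structure IsNuclearSeries (x y : ℕ → H) (T : H →L[ℂ] H) : Prop where
  summable : Summable fun n => ‖x n‖ * ‖y n‖
  hasSum : HasSum (fun n => rankOne ℂ (x n) (y n)) T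

/-- Trace-class operators on a Hilbert space, that is, nuclear operators: absolutely convergent
sums of rank-one operators. -/
def IsTraceClass (T : H →L[ℂ] H) : Prop :=
  ∃ x y : ℕ → H, IsNuclearSeries x y T

lemma IsNuclearSeries.add {x y x' y' : ℕ → H} {T T' : H →L[ℂ] H}
    (h : IsNuclearSeries x y T) (h' : IsNuclearSeries x' y' T') (e : ℕ ≃ ℕ ⊕ ℕ) :
    IsNuclearSeries (fun n => Sum.elim x x' (e n)) (fun n => Sum.elim y y' (e n)) (T + T') := by
  constructor
  · have : Summable (fun s : ℕ ⊕ ℕ => ‖Sum.elim x x' s‖ * ‖Sum.elim y y' s‖) := by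
      apply Summable.sum
      · exact h.summable
      · exact h'.summable
    have h2 := (Equiv.summable_iff e).2 this
    simpa only [Function.comp_def] using h2
  · have : HasSum (fun s : ℕ ⊕ ℕ => rankOne ℂ (Sum.elim x x' s) (Sum.elim y y' s)) (T + T') := by
      apply HasSum.sum
      · exact h.hasSum
      · exact h'.hasSum
    have h2 := (Equiv.hasSum_iff e).2 this
    simpa only [Function.comp_def] using h2

lemma IsNuclearSeries.comp_left {x y : ℕ → H} {T : H →L[ℂ] H}
    (h : IsNuclearSeries x y T) (A : H →L[ℂ] H) :
    IsNuclearSeries (fun n => A (x n)) y (A * T) := by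
  constructor
  · refine Summable.of_nonneg_of_le (fun n => by positivity) (fun n => ?_)
      (h.summable.mul_left ‖A‖)
    rw [← mul_assoc]
    exact mul_le_mul_of_nonneg_right (A.le_opNorm _) (norm_nonneg _)
  · have := h.hasSum.mul_left A
    simpa only [ContinuousLinearMap.mul_def, InnerProductSpace.comp_rankOne] using this

lemma isNuclearSeries_rankOne (x y : H) :
    IsNuclearSeries (fun n => if n = 0 then x else 0) (fun n => if n = 0 then y else 0)
      (rankOne ℂ x y) := by
  constructor
  · exact summable_of_ne_finset_zero (s := {0}) (by simp +contextual)
  · convert hasSum_ite_eq (0:ℕ) (rankOne ℂ x y) using 2 with n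
    split_ifs <;> simp

lemma isTraceClass_rankOne (x y : H) : IsTraceClass (rankOne ℂ x y) :=
  ⟨_, _, isNuclearSeries_rankOne x y⟩

variable (H) in
/-- The space of trace-class operators on `H`. -/
def TraceClass : Submodule ℂ (H →L[ℂ] H) where
  carrier := {T | IsTraceClass T}
  zero_mem' := ⟨0, 0, by simp, by simp⟩
  add_mem' := by
    rintro _ _ ⟨x, y, h⟩ ⟨x', y', h'⟩
    exact ⟨_, _, h.add h' Equiv.natSumNatEquivNat.symm⟩
  smul_mem' := by
    rintro c T ⟨x, y, h⟩
    refine ⟨_, _, by simpa using h.comp_left (c • 1)⟩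

variable [CompleteSpace H] [CompleteSpace K]

variable (H) in
/-- The index set of a fixed orthonormal basis of `H`. -/
def onbIndex : Set H := (exists_hilbertBasis ℂ H).choose

variable (H) in
/-- A fixed orthonormal basis of `H`. -/
def onb : HilbertBasis (onbIndex H) ℂ H := (exists_hilbertBasis ℂ H).choose_spec.choose

/-- The trace of an operator, computed in a fixed orthonormal basis. -/
def trace (T : H →L[ℂ] H) : ℂ := ∑' i, ⟪onb H i, T (onb H i)⟫_ℂ

lemma sum_norm_inner_le {ι : Type*} {e : ι → H} (he : Orthonormal ℂ e) (x y : H) (s : Finset ι) :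
    ∑ i ∈ s, ‖⟪y, e i⟫_ℂ * ⟪e i, x⟫_ℂ‖ ≤ ‖x‖ * ‖y‖ := by
  have h1 := Finset.sum_mul_sq_le_sq_mul_sq s (fun i => ‖⟪e i, x⟫_ℂ‖) (fun i => ‖⟪e i, y⟫_ℂ‖)
  have hx := he.sum_inner_products_le x (s := s)
  have hy := he.sum_inner_products_le y (s := s)
  have : (∑ i ∈ s, ‖⟪y, e i⟫_ℂ * ⟪e i, x⟫_ℂ‖) = ∑ i ∈ s, ‖⟪e i, x⟫_ℂ‖ * ‖⟪e i, y⟫_ℂ‖ := by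
    refine Finset.sum_congr rfl fun i _ => ?_
    rw [norm_mul, norm_inner_symm y, mul_comm]
  rw [this]
  refine abs_le_of_sq_le_sq' ?_ (by positivity) |>.2
  rw [mul_pow]
  refine h1.trans (mul_le_mul hx hy (by positivity) (by positivity))

lemma IsNuclearSeries.hasSum_inner {x y : ℕ → H} {T : H →L[ℂ] H} (h : IsNuclearSeries x y T)
    (u v : H) : HasSum (fun n => ⟪y n, v⟫_ℂ * ⟪u, x n⟫_ℂ) ⟪u, T v⟫_ℂ := by
  have h1 : HasSum (fun n => rankOne ℂ (x n) (y n) v) (T v) :=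
    h.hasSum.mapL (ContinuousLinearMap.apply ℂ H v)
  have h2 := h1.mapL (innerSL ℂ u)
  simpa [inner_smul_right] using h2

lemma IsNuclearSeries.summable_prod {x y : ℕ → H} {T : H →L[ℂ] H} (h : IsNuclearSeries x y T)
    {ι : Type*} {e : ι → H} (he : Orthonormal ℂ e) :
    Summable (fun p : ℕ × ι => ⟪y p.1, e p.2⟫_ℂ * ⟪e p.2, x p.1⟫_ℂ) := by
  apply Summable.of_norm
  refine (summable_prod_of_nonneg (fun p => norm_nonneg _)).2 ⟨fun n => ?_, ?_⟩
  · exact summable_of_sum_le (fun i => norm_nonneg _)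
      (sum_norm_inner_le he (x n) (y n))
  · refine Summable.of_nonneg_of_le (fun n => tsum_nonneg fun i => norm_nonneg _)
      (fun n => ?_) h.summable
    exact Real.tsum_le_of_sum_le (fun i => norm_nonneg _)
      (sum_norm_inner_le he (x n) (y n))

lemma IsNuclearSeries.summable_basis {x y : ℕ → H} {T : H →L[ℂ] H} (h : IsNuclearSeries x y T)
    {ι : Type*} (e : HilbertBasis ι ℂ H) : Summable fun i => ⟪e i, T (e i)⟫_ℂ := by
  have hs := (h.summable_prod e.orthonormal).prod_symm.prod
  exact hs.congr fun i => (h.hasSum_inner (e i) (e i)).tsum_eq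

/-- The trace does not depend on the orthonormal basis, and it is the sum of the `⟪yₙ, xₙ⟫`. -/
lemma IsNuclearSeries.tsum_basis {x y : ℕ → H} {T : H →L[ℂ] H} (h : IsNuclearSeries x y T)
    {ι : Type*} (e : HilbertBasis ι ℂ H) :
    ∑' i, ⟪e i, T (e i)⟫_ℂ = ∑' n, ⟪y n, x n⟫_ℂ :=
  calc ∑' i, ⟪e i, T (e i)⟫_ℂ = ∑' i, ∑' n, ⟪y n, e i⟫_ℂ * ⟪e i, x n⟫_ℂ :=
        tsum_congr fun i => (h.hasSum_inner (e i) (e i)).tsum_eq.symm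
    _ = ∑' n, ∑' i, ⟪y n, e i⟫_ℂ * ⟪e i, x n⟫_ℂ := (h.summable_prod e.orthonormal).tsum_comm
    _ = _ := tsum_congr fun n => e.tsum_inner_mul_inner _ _

lemma IsNuclearSeries.trace_eq {x y : ℕ → H} {T : H →L[ℂ] H} (h : IsNuclearSeries x y T) :
    trace T = ∑' n, ⟪y n, x n⟫_ℂ := h.tsum_basis (onb H)

lemma IsNuclearSeries.summable_inner {x y : ℕ → H} {T : H →L[ℂ] H} (h : IsNuclearSeries x y T) :
    Summable fun n => ⟪y n, x n⟫_ℂ :=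
  Summable.of_norm_bounded h.summable fun n => by
    rw [mul_comm]; exact norm_inner_le_norm _ _

/-- Conjugation of a trace-class operator by a bounded operator. -/
lemma IsNuclearSeries.conj {x y : ℕ → H} {T : H →L[ℂ] H}
    (h : IsNuclearSeries x y T) (V : H →L[ℂ] K) :
    IsNuclearSeries (fun n => V (x n)) (fun n => V (y n)) (V ∘L T ∘L V.adjoint) := by
  constructor
  · refine Summable.of_nonneg_of_le (fun n => by positivity) (fun n => ?_)
      (h.summable.mul_left (‖V‖ * ‖V‖))
    calc _ ≤ (‖V‖ * ‖x n‖) * (‖V‖ * ‖y n‖) := by gcongr <;> exact V.le_opNorm _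
      _ = _ := by ring
  · have h1 := h.hasSum.mapL (ContinuousLinearMap.compL ℂ H H K V)
    have h2 := h1.mapL ((ContinuousLinearMap.compL ℂ K H K).flip V.adjoint)
    simpa [InnerProductSpace.comp_rankOne, InnerProductSpace.rankOne_comp,
      ContinuousLinearMap.comp_assoc] using h2

lemma IsNuclearSeries.comp_right {x y : ℕ → H} {T : H →L[ℂ] H}
    (h : IsNuclearSeries x y T) (A : H →L[ℂ] H) :
    IsNuclearSeries x (fun n => A.adjoint (y n)) (T * A) := by
  constructor
  · refine Summable.of_nonneg_of_le (fun n => by positivity) (fun n => ?_)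
      (h.summable.mul_left ‖A.adjoint‖)
    calc _ ≤ ‖x n‖ * (‖A.adjoint‖ * ‖y n‖) := by gcongr; exact A.adjoint.le_opNorm _
      _ = _ := by ring
  · have := h.hasSum.mul_right A
    simpa only [ContinuousLinearMap.mul_def, InnerProductSpace.rankOne_comp] using this

lemma isTraceClass_mul_left {T : H →L[ℂ] H} (hT : IsTraceClass T) (A : H →L[ℂ] H) :
    IsTraceClass (A * T) := by
  obtain ⟨x, y, h⟩ := hT
  exact ⟨_, _, h.comp_left A⟩

lemma isTraceClass_mul_right {T : H →L[ℂ] H} (hT : IsTraceClass T) (A : H →L[ℂ] H) :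
    IsTraceClass (T * A) := by
  obtain ⟨x, y, h⟩ := hT
  exact ⟨_, _, h.comp_right A⟩

lemma trace_mul_comm {T : H →L[ℂ] H} (hT : IsTraceClass T) (A : H →L[ℂ] H) :
    trace (T * A) = trace (A * T) := by
  obtain ⟨x, y, h⟩ := hT
  rw [(h.comp_right A).trace_eq, (h.comp_left A).trace_eq]
  simp [ContinuousLinearMap.adjoint_inner_left]

lemma trace_rankOne (x y : H) : trace (rankOne ℂ x y) = ⟪y, x⟫_ℂ := by
  rw [(isNuclearSeries_rankOne x y).trace_eq, tsum_eq_single 0 (by simp +contextual)]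
  simp

lemma trace_mul_rankOne (A : H →L[ℂ] H) (x y : H) : trace (A * rankOne ℂ x y) = ⟪y, A x⟫_ℂ := by
  rw [← trace_rankOne, ContinuousLinearMap.mul_def, InnerProductSpace.comp_rankOne]

lemma IsTraceClass.summable_diag {T : H →L[ℂ] H} (hT : IsTraceClass T) :
    Summable fun i => ⟪onb H i, T (onb H i)⟫_ℂ := by
  obtain ⟨x, y, h⟩ := hT
  exact h.summable_basis (onb H)

lemma trace_add {S T : H →L[ℂ] H} (hS : IsTraceClass S) (hT : IsTraceClass T) :
    trace (S + T) = trace S + trace T := by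
  simp only [trace, add_apply, inner_add_right]
  exact hS.summable_diag.tsum_add hT.summable_diag

lemma trace_smul (c : ℂ) (T : H →L[ℂ] H) : trace (c • T) = c * trace T := by
  simp only [trace, smul_apply, inner_smul_right, tsum_mul_left]

lemma trace_nonneg {T : H →L[ℂ] H} (hT : T.IsPositive) : 0 ≤ trace T :=
  tsum_nonneg fun i => hT.inner_nonneg_right _

lemma trace_mul_nonneg {P T : H →L[ℂ] H} (hP : P.IsPositive) (hT : T.IsPositive)
    (hT' : IsTraceClass T) : 0 ≤ trace (P * T) := by
  obtain ⟨S, hS, rfl⟩ : ∃ S : H →L[ℂ] H, S.adjoint = S ∧ S * S = P := by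
    have hP' := (ContinuousLinearMap.nonneg_iff_isPositive P).2 hP
    refine ⟨CFC.sqrt P, ?_, CFC.sqrt_mul_sqrt_self P hP'⟩
    exact ((CFC.sqrt_nonneg P).isSelfAdjoint).star_eq
  rw [mul_assoc, ← trace_mul_comm (isTraceClass_mul_left hT' S), mul_assoc]
  have := hT.conj_adjoint S
  rw [hS] at this
  exact trace_nonneg (by simpa [ContinuousLinearMap.mul_def] using this)

lemma norm_trace_mul_le_of_isSelfAdjoint {A T : H →L[ℂ] H} (hA : IsSelfAdjoint A)
    (hT : T.IsPositive) (hT' : IsTraceClass T) :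
    ‖trace (A * T)‖ ≤ ‖A‖ * (trace T).re := by
  have h1 : ((‖A‖ : ℂ) • (1 : H →L[ℂ] H) + A).IsPositive := by
    rw [← ContinuousLinearMap.nonneg_iff_isPositive]
    have := hA.neg_algebraMap_norm_le_self
    rw [neg_le_iff_add_nonneg', Algebra.algebraMap_eq_smul_one] at this
    simpa using this
  have h2 : ((‖A‖ : ℂ) • (1 : H →L[ℂ] H) - A).IsPositive := by
    rw [← ContinuousLinearMap.nonneg_iff_isPositive]
    have := hA.le_algebraMap_norm_self
    rw [← sub_nonneg, Algebra.algebraMap_eq_smul_one] at this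
    simpa using this
  have e1 := trace_mul_nonneg h1 hT hT'
  have e2 := trace_mul_nonneg h2 hT hT'
  have hAT := isTraceClass_mul_left hT' A
  have hcT : IsTraceClass ((‖A‖ : ℂ) • T) := (TraceClass H).smul_mem _ hT'
  rw [add_mul, smul_mul_assoc, one_mul, trace_add hcT hAT, trace_smul] at e1
  rw [sub_eq_add_neg, add_mul, smul_mul_assoc, one_mul, neg_mul, ← neg_one_smul ℂ (A * T),
    trace_add hcT ((TraceClass H).smul_mem _ hAT), trace_smul, trace_smul] at e2
  have e3 := trace_nonneg hT
  rw [Complex.le_def] at e1 e2 e3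
  simp at e1 e2 e3
  have him : (trace (A * T)).im = 0 := by have := e1.2; rw [← e3.2] at this; simpa using this.symm
  have : trace (A * T) = ((trace (A * T)).re : ℂ) := Complex.ext rfl (by simp [him])
  rw [this, Complex.norm_real, Real.norm_eq_abs, abs_le]
  constructor <;> linarith [e1.1, e2.1]

lemma norm_trace_mul_le {A T : H →L[ℂ] H} (hT : T.IsPositive) (hT' : IsTraceClass T) :
    ‖trace (A * T)‖ ≤ 2 * ‖A‖ * (trace T).re := by
  have hA : A = ((realPart A : selfAdjoint (H →L[ℂ] H)) : H →L[ℂ] H)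
      + Complex.I • ((imaginaryPart A : selfAdjoint (H →L[ℂ] H)) : H →L[ℂ] H) :=
    (realPart_add_I_smul_imaginaryPart A).symm
  have e3 : 0 ≤ (trace T).re := (Complex.le_def.1 (trace_nonneg hT)).1
  have t1 := isTraceClass_mul_left hT' (realPart A : H →L[ℂ] H)
  have t2 := isTraceClass_mul_left hT' (imaginaryPart A : H →L[ℂ] H)
  have n1 := norm_trace_mul_le_of_isSelfAdjoint (realPart A).2 hT hT'
  have n2 := norm_trace_mul_le_of_isSelfAdjoint (imaginaryPart A).2 hT hT'
  have m1 : ‖(realPart A : H →L[ℂ] H)‖ ≤ ‖A‖ := realPart.norm_le A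
  have m2 : ‖(imaginaryPart A : H →L[ℂ] H)‖ ≤ ‖A‖ := imaginaryPart.norm_le A
  have : trace (A * T) = trace ((realPart A : H →L[ℂ] H) * T)
      + Complex.I * trace ((imaginaryPart A : H →L[ℂ] H) * T) := by
    conv_lhs => rw [hA]
    rw [add_mul, smul_mul_assoc, trace_add t1 ((TraceClass H).smul_mem _ t2), trace_smul]
  rw [this]
  refine (norm_add_le _ _).trans ?_
  rw [norm_mul, Complex.norm_I, one_mul]
  nlinarith [mul_le_mul_of_nonneg_right m1 e3, mul_le_mul_of_nonneg_right m2 e3]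


lemma exists_balanced (x y : H) : ∃ a b : H, rankOne ℂ a b = rankOne ℂ x y ∧
    ‖a‖ ^ 2 = ‖x‖ * ‖y‖ ∧ ‖b‖ ^ 2 = ‖x‖ * ‖y‖ := by
  by_cases hx : x = 0
  · exact ⟨0, 0, by simp [hx]⟩
  by_cases hy : y = 0
  · exact ⟨0, 0, by simp [hy]⟩
  have hx' : 0 < ‖x‖ := norm_pos_iff.2 hx
  have hy' : 0 < ‖y‖ := norm_pos_iff.2 hy
  set t : ℝ := Real.sqrt (‖y‖ / ‖x‖) with ht
  have ht0 : 0 < t := Real.sqrt_pos.2 (by positivity)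
  have ht2 : t ^ 2 = ‖y‖ / ‖x‖ := Real.sq_sqrt (by positivity)
  have htC : (t : ℂ) ≠ 0 := by exact_mod_cast ht0.ne'
  refine ⟨(t : ℂ) • x, ((t⁻¹ : ℝ) : ℂ) • y, ?_, ?_, ?_⟩
  · ext v
    simp only [InnerProductSpace.rankOne_apply, inner_smul_left, smul_smul, Complex.conj_ofReal]
    congr 1
    push_cast
    field_simp
  · rw [norm_smul, Complex.norm_real, Real.norm_eq_abs, abs_of_pos ht0, mul_pow, ht2]
    field_simp
  · rw [norm_smul, Complex.norm_real, Real.norm_eq_abs, abs_of_pos (inv_pos.2 ht0), mul_pow,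
      inv_pow, ht2]
    field_simp

lemma isPositive_of_inner_nonneg {T : H →L[ℂ] H} (h : ∀ v, 0 ≤ ⟪v, T v⟫_ℂ) : T.IsPositive := by
  rw [ContinuousLinearMap.isPositive_iff_complex]
  intro v
  rw [← inner_conj_symm]
  have h1 := Complex.le_def.1 (h v)
  generalize ⟪v, T v⟫_ℂ = z at h1
  simp only [Complex.zero_re, Complex.zero_im] at h1
  exact ⟨Complex.ext (by simp) (by simp [← h1.2]), by simpa using h1.1⟩

lemma isNuclearSeries_diag {a b : ℕ → H} {s : ℕ → ℝ} (hs : Summable s)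
    (ha : ∀ n, ‖a n‖ ^ 2 = s n) (hb : ∀ n, ‖b n‖ ^ 2 = s n) {c : ℂ} (hc : ‖c‖ = 1) :
    ∃ P : H →L[ℂ] H, IsNuclearSeries (fun n => a n + c • b n) (fun n => a n + c • b n) P ∧
      P.IsPositive ∧ (trace P).re ≤ 4 * ∑' n, s n := by
  have hle : ∀ n, ‖a n + c • b n‖ * ‖a n + c • b n‖ ≤ 4 * s n := by
    intro n
    have h1 : ‖a n + c • b n‖ ≤ ‖a n‖ + ‖b n‖ := by
      refine (norm_add_le _ _).trans ?_
      rw [norm_smul, hc, one_mul]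
    have h2 := mul_self_le_mul_self (norm_nonneg _) h1
    nlinarith [ha n, hb n, sq_nonneg (‖a n‖ - ‖b n‖)]
  have hsum : Summable fun n => ‖a n + c • b n‖ * ‖a n + c • b n‖ :=
    Summable.of_nonneg_of_le (fun n => by positivity) hle (hs.mul_left 4)
  have hP : Summable fun n => rankOne ℂ (a n + c • b n) (a n + c • b n) :=
    Summable.of_norm (by simpa only [InnerProductSpace.norm_rankOne] using hsum)
  have hN : IsNuclearSeries (fun n => a n + c • b n) (fun n => a n + c • b n) (∑' n, _) :=
    ⟨hsum, hP.hasSum⟩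
  refine ⟨_, hN, ?_, ?_⟩
  · refine isPositive_of_inner_nonneg fun v => (hN.hasSum_inner v v).nonneg fun n => ?_
    rw [← inner_conj_symm v (a n + c • b n), mul_comm, ← Complex.star_def]
    exact star_mul_self_nonneg _
  · rw [hN.trace_eq]
    have e : ∀ n, ⟪a n + c • b n, a n + c • b n⟫_ℂ
        = ((‖a n + c • b n‖ * ‖a n + c • b n‖ : ℝ) : ℂ) := by
      intro n
      rw [inner_self_eq_norm_sq_to_K]; push_cast; simp [sq]
    rw [tsum_congr e, ← Complex.ofReal_tsum, Complex.ofReal_re, ← tsum_mul_left]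
    exact hsum.tsum_le_tsum hle (hs.mul_left 4)

lemma norm_functional_le {f : TraceClass H →ₗ[ℂ] ℂ} {C : ℝ}
    (hf : ∀ ρ : TraceClass H, (ρ : H →L[ℂ] H).IsPositive → ‖f ρ‖ ≤ C * (trace (ρ : H →L[ℂ] H)).re)
    (hC : 0 ≤ C) {x y : ℕ → H} {T : H →L[ℂ] H} (h : IsNuclearSeries x y T) :
    ‖f ⟨T, x, y, h⟩‖ ≤ 4 * C * ∑' n, ‖x n‖ * ‖y n‖ := by
  choose a b hab ha hb using fun n => exists_balanced (x n) (y n)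
  set S := ∑' n, ‖x n‖ * ‖y n‖ with hS
  have key : ∀ c : ℂ, ‖c‖ = 1 → ∃ P : TraceClass H, ‖f P‖ ≤ 4 * C * S ∧
      HasSum (fun n => rankOne ℂ (a n + c • b n) (a n + c • b n)) (P : H →L[ℂ] H) := by
    intro c hc
    obtain ⟨P, hN, hpos, htr⟩ := isNuclearSeries_diag h.summable ha hb hc
    refine ⟨⟨P, _, _, hN⟩, (hf _ hpos).trans ?_, hN.hasSum⟩
    have := mul_le_mul_of_nonneg_left htr hC
    simp only at this ⊢
    linarith
  obtain ⟨P1, n1, s1⟩ := key 1 (by simp)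
  obtain ⟨P2, n2, s2⟩ := key Complex.I (by simp)
  obtain ⟨P3, n3, s3⟩ := key (-1) (by simp)
  obtain ⟨P4, n4, s4⟩ := key (-Complex.I) (by simp)
  have hsum := ((((s1.add (s2.const_smul Complex.I)).add (s3.const_smul (-1 : ℂ))).add
    (s4.const_smul (-Complex.I))).const_smul (1/4 : ℂ))
  have hT : T = (1/4 : ℂ) • ((P1 : H →L[ℂ] H) + Complex.I • (P2 : H →L[ℂ] H)
      + (-1 : ℂ) • (P3 : H →L[ℂ] H) + (-Complex.I) • (P4 : H →L[ℂ] H)) := by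
    refine h.hasSum.unique ?_
    refine Eq.subst (motive := fun F => HasSum F _) (funext fun n => ?_) hsum
    rw [← hab n]
    ext v
    simp only [map_add, map_smulₛₗ, add_apply, smul_apply, InnerProductSpace.rankOne_apply,
      map_neg, map_one, Complex.conj_I, RingHom.id_apply, smul_add, smul_smul]
    match_scalars <;> ring_nf <;> simp only [Complex.I_sq] <;> ring_nf
  have hT' : (⟨T, x, y, h⟩ : TraceClass H) = (1/4 : ℂ) • (P1 + Complex.I • P2
      + (-1 : ℂ) • P3 + (-Complex.I) • P4) := Subtype.ext hT
  rw [hT', map_smul, map_add, map_add, map_add, map_smul, map_smul, map_smul, norm_smul]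
  have hn := norm_add₄_le (a := f P1) (b := Complex.I • f P2) (c := (-1 : ℂ) • f P3)
    (d := (-Complex.I) • f P4)
  simp only [norm_smul, norm_neg, Complex.norm_I, norm_one, one_mul] at hn
  have : ‖(1/4 : ℂ)‖ = 1/4 := by norm_num
  rw [this]
  linarith

lemma exists_operator_of_functional {f : TraceClass H →ₗ[ℂ] ℂ} {C : ℝ}
    (hf : ∀ ρ : TraceClass H, (ρ : H →L[ℂ] H).IsPositive → ‖f ρ‖ ≤ C * (trace (ρ : H →L[ℂ] H)).re)
    (hC : 0 ≤ C) : ∃ B : H →L[ℂ] H, ∀ ρ : TraceClass H, f ρ = trace (B * (ρ : H →L[ℂ] H)) := by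
  let r : H → H → TraceClass H := fun x y => ⟨rankOne ℂ x y, isTraceClass_rankOne x y⟩
  have hr : ∀ x y, ‖f (r x y)‖ ≤ 4 * C * (‖y‖ * ‖x‖) := by
    intro x y
    refine (norm_functional_le hf hC (isNuclearSeries_rankOne x y)).trans_eq ?_
    rw [tsum_eq_single 0 (by simp +contextual)]
    simp [mul_comm]
  let g : H →ₗ⋆[ℂ] H →ₗ[ℂ] ℂ := LinearMap.mk₂'ₛₗ _ _ (fun y x => f (r x y))
    (fun y y' x => by
      rw [← map_add]; congr 1; exact Subtype.ext (by simp [r]))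
    (fun c y x => by
      rw [← map_smul]; congr 1; exact Subtype.ext (by simp [r]))
    (fun y x x' => by
      rw [← map_add]; congr 1; exact Subtype.ext (by simp [r]))
    (fun c y x => by
      rw [← map_smul]; congr 1; exact Subtype.ext (by simp [r]))
  let G : H →L⋆[ℂ] H →L[ℂ] ℂ := g.mkContinuous₂ (4 * C) fun y x => by
    rw [mul_assoc (4 * C)]; exact hr x y
  let B : H →L[ℂ] H := (InnerProductSpace.continuousLinearMapOfBilin G).adjoint
  have hB : ∀ x y, ⟪y, B x⟫_ℂ = f (r x y) := by
    intro x y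
    rw [ContinuousLinearMap.adjoint_inner_right, InnerProductSpace.continuousLinearMapOfBilin_apply]
    rfl
  refine ⟨B, ?_⟩
  rintro ⟨T, x, y, h⟩
  have htr : HasSum (fun n => f (r (x n) (y n))) (trace (B * T)) := by
    have hN := h.comp_left B
    rw [hN.trace_eq]
    have := hN.summable_inner.hasSum
    simpa only [hB] using this
  refine tendsto_nhds_unique ?_ htr.tendsto_sum_nat
  rw [tendsto_iff_norm_sub_tendsto_zero]
  have htail : ∀ N, IsNuclearSeries (fun n => x (n + N)) (fun n => y (n + N))
      (T - ∑ n ∈ Finset.range N, rankOne ℂ (x n) (y n)) := fun N =>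
    ⟨(summable_nat_add_iff N).2 h.summable, (hasSum_nat_add_iff' N).2 h.hasSum⟩
  have hlim : Filter.Tendsto (fun N => 4 * C * ∑' n, ‖x (n + N)‖ * ‖y (n + N)‖)
      Filter.atTop (nhds 0) := by
    have := (tendsto_sum_nat_add fun n => ‖x n‖ * ‖y n‖).const_mul (4 * C)
    simpa using this
  refine squeeze_zero (fun N => norm_nonneg _) (fun N => ?_) hlim
  refine le_trans (le_of_eq ?_) (norm_functional_le hf hC (htail N))
  rw [← map_sum, norm_sub_rev, ← map_sub]
  congr 2
  exact Subtype.ext (by simp [r])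

end TraceClass

section Channel

variable {H K : Type*} [NormedAddCommGroup H] [InnerProductSpace ℂ H] [CompleteSpace H]
  [NormedAddCommGroup K] [InnerProductSpace ℂ K] [CompleteSpace K]

/-- Positivity of the block operator `[M i j]` on the `n`-fold direct sum of `H`. -/
def IsPositiveBlock {n : ℕ} (M : Fin n → Fin n → H →L[ℂ] H) : Prop :=
  ∀ v : Fin n → H, 0 ≤ ∑ i, ∑ j, ⟪v i, M i j (v j)⟫_ℂ

variable (H K) in
/-- Quantum channels: linear completely positive trace-preserving maps between trace classes. -/
structure Channel where
  /-- the underlying linear map -/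
  toLin : TraceClass H →ₗ[ℂ] TraceClass K
  completelyPositive : ∀ (n : ℕ) (M : Fin n → Fin n → TraceClass H),
    IsPositiveBlock (fun i j => (M i j : H →L[ℂ] H)) →
    IsPositiveBlock (fun i j => (toLin (M i j) : K →L[ℂ] K))
  tracePreserving : ∀ ρ : TraceClass H,
    trace (toLin ρ : K →L[ℂ] K) = trace (ρ : H →L[ℂ] H)

namespace Channel

lemma isPositive_toLin (Φ : Channel H K) {ρ : TraceClass H} (hρ : (ρ : H →L[ℂ] H).IsPositive) :
    (Φ.toLin ρ : K →L[ℂ] K).IsPositive := by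
  refine isPositive_of_inner_nonneg fun v => ?_
  have := Φ.completelyPositive 1 (fun _ _ => ρ)
    (fun w => by simpa using hρ.inner_nonneg_right (w 0)) (fun _ => v)
  simpa using this

lemma exists_unique_dual (Φ : Channel H K) (A : K →L[ℂ] K) :
    ∃! B : H →L[ℂ] H, ∀ ρ : TraceClass H,
      trace (A * (Φ.toLin ρ : K →L[ℂ] K)) = trace (B * (ρ : H →L[ℂ] H)) := by
  let f : TraceClass H →ₗ[ℂ] ℂ :=
    { toFun := fun ρ => trace (A * (Φ.toLin ρ : K →L[ℂ] K))
      map_add' := fun ρ σ => by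
        rw [map_add, Submodule.coe_add, mul_add,
          trace_add (isTraceClass_mul_left (Φ.toLin ρ).2 A)
            (isTraceClass_mul_left (Φ.toLin σ).2 A)]
      map_smul' := fun c ρ => by
        rw [map_smul, Submodule.coe_smul, mul_smul_comm, trace_smul]; rfl }
  obtain ⟨B, hB⟩ := exists_operator_of_functional (f := f) (C := 2 * ‖A‖) (fun ρ hρ => by
    rw [← Φ.tracePreserving ρ]
    exact norm_trace_mul_le (Φ.isPositive_toLin hρ) (Φ.toLin ρ).2) (by positivity)
  refine ⟨B, hB, fun B' hB' => ?_⟩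
  refine ContinuousLinearMap.ext fun x => ext_inner_left ℂ fun y => ?_
  rw [← trace_mul_rankOne, ← trace_mul_rankOne]
  exact (hB' ⟨_, isTraceClass_rankOne x y⟩).symm.trans (hB ⟨_, isTraceClass_rankOne x y⟩)

/-- The dual channel `Φ^* : B(K) → B(H)`, determined by `Tr (A Φ[ρ]) = Tr (Φ^*[A] ρ)`. -/
def dual (Φ : Channel H K) (A : K →L[ℂ] K) : H →L[ℂ] H := (Φ.exists_unique_dual A).choose

lemma trace_dual_mul (Φ : Channel H K) (A : K →L[ℂ] K) (ρ : TraceClass H) :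
    trace (A * (Φ.toLin ρ : K →L[ℂ] K)) = trace (Φ.dual A * (ρ : H →L[ℂ] H)) :=
  (Φ.exists_unique_dual A).choose_spec.1 ρ

/-- The image of the dual channel consists of commuting operators. -/
def IsClassicalQuantum (Φ : Channel H K) : Prop :=
  ∀ A B : K →L[ℂ] K, Commute (Φ.dual A) (Φ.dual B)

/-- Classical-quantum channels of discrete type: the image of the dual channel consists of
operators that are all diagonal in one fixed orthonormal basis. -/
def IsDiscreteClassicalQuantum (Φ : Channel H K) : Prop :=
  Φ.IsClassicalQuantum ∧ ∃ (s : Set H) (e : HilbertBasis s ℂ H),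
    ∀ (A : K →L[ℂ] K) (i : s), ∃ c : ℂ, Φ.dual A (e i) = c • e i

/-- Completely depolarizing channels: every input is sent to one fixed state. -/
def IsCompletelyDepolarizing (Φ : Channel H K) : Prop :=
  ∃ σ : TraceClass K, (σ : K →L[ℂ] K).IsPositive ∧ trace (σ : K →L[ℂ] K) = 1 ∧
    ∀ ρ : TraceClass H, Φ.toLin ρ = trace (ρ : H →L[ℂ] H) • σ

/-- Operators on a closed subspace `L`, extended by zero on the orthogonal complement. -/
def extendTraceClass (L : Submodule ℂ H) [CompleteSpace L] : TraceClass L →ₗ[ℂ] TraceClass H where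
  toFun ρ := ⟨L.subtypeL ∘L (ρ : L →L[ℂ] L) ∘L L.subtypeL.adjoint, by
    obtain ⟨x, y, h⟩ := ρ.2
    exact ⟨_, _, h.conj L.subtypeL⟩⟩
  map_add' ρ σ := Subtype.ext (by simp)
  map_smul' c ρ := Subtype.ext (by simp)

lemma trace_extendTraceClass (L : Submodule ℂ H) [CompleteSpace L] (ρ : TraceClass L) :
    trace (extendTraceClass L ρ : H →L[ℂ] H) = trace (ρ : L →L[ℂ] L) := by
  obtain ⟨T, x, y, h⟩ := ρ
  exact (h.conj L.subtypeL).trace_eq.trans h.trace_eq.symm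

/-- The subchannel of `Φ` that corresponds to a closed subspace `L`: the restriction of `Φ` to the
operators that live on `L`. -/
def subchannel (Φ : Channel H K) (L : Submodule ℂ H) [CompleteSpace L] : Channel L K where
  toLin := Φ.toLin ∘ₗ extendTraceClass L
  completelyPositive n M hM := by
    refine Φ.completelyPositive n (fun i j => extendTraceClass L (M i j)) fun v => ?_
    have := hM fun i => L.subtypeL.adjoint (v i)
    simp only [ContinuousLinearMap.adjoint_inner_left] at this
    exact this
  tracePreserving ρ := (Φ.tracePreserving _).trans (trace_extendTraceClass L ρ)

end Channel

end Channel

section Gaussian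

open Matrix

variable {ι κ : Type*} [Fintype ι] [Fintype κ]

/-- Commutation matrices of coordinate symplectic spaces: real, skew-symmetric, nondegenerate. -/
structure IsSymplecticMatrix [DecidableEq ι] (Δ : Matrix ι ι ℝ) : Prop where
  skew : Δᵀ = -Δ
  nondegenerate : Δ.det ≠ 0

variable {H K : Type*} [NormedAddCommGroup H] [InnerProductSpace ℂ H] [CompleteSpace H]
  [NormedAddCommGroup K] [InnerProductSpace ℂ K] [CompleteSpace K]

/-- Irreducible Weyl systems over the coordinate symplectic space `(ℝ^ι, Δ)`: strongly continuous
families of unitary operators with the canonical commutation relations and without nontrivial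
closed invariant subspaces. (By Stone's theorem, strong continuity says that
`W z = exp (i R · z)` with self-adjoint operators `R · z`.) -/
structure IsIrreducibleWeylSystem (Δ : Matrix ι ι ℝ) (W : (ι → ℝ) → H →L[ℂ] H) : Prop where
  unitary : ∀ z, W z ∈ unitary (H →L[ℂ] H)
  ccr : ∀ z z', W z * W z' =
    Complex.exp (-(Complex.I / 2) * ((z ⬝ᵥ Δ *ᵥ z' : ℝ) : ℂ)) • W (z' + z)
  continuous : ∀ ψ : H, Continuous fun z => W z ψ
  nontrivial : Nontrivial H
  irreducible : ∀ L : Submodule ℂ H, IsClosed (L : Set H) →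
    (∀ z, ∀ ψ ∈ L, W z ψ ∈ L) → L = ⊥ ∨ L = ⊤

/-- `Φ` is the Bosonic Gaussian channel with parameters `M` (the matrix `K`), `l`, `α`. -/
structure IsGaussianChannel (ΔA : Matrix ι ι ℝ) (ΔB : Matrix κ κ ℝ)
    (WA : (ι → ℝ) → H →L[ℂ] H) (WB : (κ → ℝ) → K →L[ℂ] K)
    (M : Matrix ι κ ℝ) (l : κ → ℝ) (α : Matrix κ κ ℝ) (Φ : Channel H K) : Prop where
  dual_weyl : ∀ z : κ → ℝ, Φ.dual (WB z) =
    Complex.exp (Complex.I * ((l ⬝ᵥ z : ℝ) : ℂ) - 1 / 2 * ((z ⬝ᵥ α *ᵥ z : ℝ) : ℂ)) • WA (M *ᵥ z)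
  symm : αᵀ = α
  posSemidef_add : (α.map Complex.ofReal +
    (Complex.I / 2) • (ΔB - Mᵀ * ΔA * M).map Complex.ofReal).PosSemidef
  posSemidef_sub : (α.map Complex.ofReal -
    (Complex.I / 2) • (ΔB - Mᵀ * ΔA * M).map Complex.ofReal).PosSemidef

end Gaussian

end

end QChannel

namespace QChannel

noncomputable section

open scoped InnerProductSpace ComplexOrder
open InnerProductSpace (rankOne)

/-! ### Trace pairings against an irreducible star-closed monoid of operators -/

section Irreducible

variable {H : Type*} [NormedAddCommGroup H] [InnerProductSpace ℂ H]

/-! The pivot is that a trace-class operator `T` is determined by its characteristic function `z ↦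
Tr (W z * T)`. Writing `T = ∑ |aₙ⟩⟨bₙ|` with `a`, `b` square-summable turns `Tr (A T)` into the
matrix element of `A ⊗ 1` between two vectors `u`, `w` of `H ⊗ ℓ²`. The double commutant argument
applies: the projection onto the closed cyclic subspace of `u` commutes with `W z ⊗ 1`, so by
Schur's lemma its blocks are scalars, and it commutes with every `B ⊗ 1`. If `w` is orthogonal to
that subspace, then `Tr (B T) = 0` for all bounded `B`, hence `T = 0`
(`IsIrreducibleMonoid.eq_zero_of_trace_mul_eq_zero`).

A Gaussian channel sends `W_B(z)` to a nonzero multiple of `W_A(Kz)`. Two such operators commute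
exactly when their Weyl phase is 1, and rescaling `z` turns this into the vanishing of the form `Kᵀ
Δ_A K`. Applied to `Φ[ρ]`, the uniqueness of characteristic functions carries commutation from the
images of Weyl operators to the whole image of `Φ^*` (`Channel.commute_dual_of_weyl`), and shows
that for `K = 0` the output depends on `ρ` only through its trace.

A channel of discrete type would give a common eigenvector of all `W_A(tKz)`, `t` real, which the
canonical commutation relations and strong continuity forbid unless `Kz = 0`
(`eq_zero_of_eigenvector`). If `K` has full rank, a discrete subchannel would give nonzero `u`, `v`
with `⟪u, W_A(w) v⟫ = 0` for all `w`, so `|v⟩⟨u|` would have zero characteristic function. -/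

/-- The operator `A ⊗ 1` on `H ⊗ ℓ²(ℕ)`, the square-summable sequences in `H`. -/
def ampliation (A : H →L[ℂ] H) :
    lp (fun _ : ℕ => H) 2 →L[ℂ] lp (fun _ : ℕ => H) 2 :=
  LinearMap.mkContinuous
    { toFun := fun v => ⟨fun n => A (v n), Memℓp.mono ((lp.memℓp v).norm.const_mul ‖A‖)
        fun n => A.le_opNorm (v n)⟩
      map_add' := fun u v => lp.ext (funext fun n => A.map_add (u n) (v n))
      map_smul' := fun c v => lp.ext (funext fun n => A.map_smul c (v n)) } ‖A‖ fun v => by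
    have h : ‖((‖A‖ : ℂ) • v)‖ = ‖A‖ * ‖v‖ := by rw [norm_smul]; simp
    rw [← h]
    refine lp.norm_mono two_ne_zero fun n => ?_
    change ‖A (v n)‖ ≤ ‖(‖A‖ : ℂ) • v n‖
    simpa [norm_smul] using A.le_opNorm (v n)

@[simp] lemma ampliation_apply (A : H →L[ℂ] H) (v : lp (fun _ : ℕ => H) 2) (n : ℕ) :
    ampliation A v n = A (v n) := rfl

lemma ampliation_one (v : lp (fun _ : ℕ => H) 2) : ampliation (1 : H →L[ℂ] H) v = v :=
  lp.ext (funext fun n => by simp)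

lemma ampliation_mul (A B : H →L[ℂ] H) (v : lp (fun _ : ℕ => H) 2) :
    ampliation (A * B) v = ampliation A (ampliation B v) :=
  lp.ext (funext fun n => by simp)

lemma ampliation_single (A : H →L[ℂ] H) (n : ℕ) (x : H) :
    ampliation A (lp.single 2 n x) = lp.single 2 n (A x) := by
  refine lp.ext (funext fun k => ?_)
  by_cases h : k = n
  · subst h; simp
  · simp [h]

variable [CompleteSpace H]

/-- A star-closed monoid of bounded operators without nontrivial closed invariant subspaces. -/
structure IsIrreducibleMonoid (S : Submonoid (H →L[ℂ] H)) : Prop where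
  star_mem : ∀ A ∈ S, star A ∈ S
  irreducible : ∀ L : Submodule ℂ H, IsClosed (L : Set H) →
    (∀ A ∈ S, ∀ ψ ∈ L, A ψ ∈ L) → L = ⊥ ∨ L = ⊤

/-- If the spectrum had two points, functional calculus with two functions of disjoint supports
would give nonzero operators with product zero. The kernel of the first commutes past the monoid, so
it is an invariant subspace that is neither zero nor everything. -/
lemma IsIrreducibleMonoid.exists_eq_smul_one_of_isSelfAdjoint {S : Submonoid (H →L[ℂ] H)}
    (hS : IsIrreducibleMonoid S) {B : H →L[ℂ] H} (hB : IsSelfAdjoint B)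
    (hc : ∀ A ∈ S, Commute B A) : ∃ c : ℂ, B = c • (1 : H →L[ℂ] H) := by
  by_cases hsub : (spectrum ℝ B).Subsingleton
  · obtain h | ⟨r, h⟩ := hsub.eq_empty_or_singleton
    · refine ⟨0, ?_⟩
      rw [CFC.eq_algebraMap_of_spectrum_subset_singleton (R := ℝ) B 0 (by simp [h]) hB]
      simp
    · refine ⟨r, ?_⟩
      rw [CFC.eq_algebraMap_of_spectrum_subset_singleton (R := ℝ) B r h.subset hB,
        Algebra.algebraMap_eq_smul_one]
      simp
  · exfalso
    rw [Set.not_subsingleton_iff] at hsub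
    obtain ⟨a, ha, b, hb, hab⟩ := hsub.exists_lt
    -- Negative and positive parts of `x - m`: their product vanishes, while `f a > 0` and `g b > 0`
    -- at spectral points, so neither `cfc` is zero.
    set m := (a + b) / 2 with hm
    set f : ℝ → ℝ := fun x => max (m - x) 0 with hf
    set g : ℝ → ℝ := fun x => max (x - m) 0 with hg
    have hfc : Continuous f := by fun_prop
    have hgc : Continuous g := by fun_prop
    have hf0 : cfc f B ≠ 0 := fun h0 => by
      have := eqOn_of_cfc_eq_cfc (R := ℝ) (f := f) (g := fun _ => 0) (a := B) (by simpa using h0)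
        (hf := hfc.continuousOn) (ha := hB)
      have := this ha
      simp only [hf, hm] at this
      have := le_max_left ((a + b) / 2 - a) 0
      linarith
    have hg0 : cfc g B ≠ 0 := fun h0 => by
      have := eqOn_of_cfc_eq_cfc (R := ℝ) (f := g) (g := fun _ => 0) (a := B) (by simpa using h0)
        (hf := hgc.continuousOn) (ha := hB)
      have := this hb
      simp only [hg, hm] at this
      have := le_max_left (b - (a + b) / 2) 0
      linarith
    have hmul : cfc f B * cfc g B = 0 := by
      rw [← cfc_mul f g B hfc.continuousOn hgc.continuousOn]
      have : (fun x => f x * g x) = fun _ => 0 := by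
        funext x
        rcases le_total x m with h | h
        · simp [hg, h]
        · simp [hf, h]
      rw [this, cfc_const_zero]
    have hker := hS.irreducible (LinearMap.ker (cfc f B).toLinearMap)
      (ContinuousLinearMap.isClosed_ker _) fun A hA ψ hψ => by
        have h1 : Commute (cfc f B) A := (hc A hA).cfc_real f
        have h2 := congrArg (fun T : H →L[ℂ] H => T ψ) h1.eq
        simp only [LinearMap.mem_ker, ContinuousLinearMap.coe_coe] at hψ ⊢
        exact h2.trans ((congrArg A hψ).trans (map_zero A))
    rcases hker with h | h
    · apply hg0
      ext v
      have : cfc g B v ∈ LinearMap.ker (cfc f B).toLinearMap := by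
        simpa using congrArg (fun T : H →L[ℂ] H => T v) hmul
      rw [h] at this
      simpa using this
    · apply hf0
      ext v
      have : v ∈ LinearMap.ker (cfc f B).toLinearMap := by rw [h]; trivial
      simpa using this

/-- Schur's lemma. -/
lemma IsIrreducibleMonoid.exists_eq_smul_one {S : Submonoid (H →L[ℂ] H)}
    (hS : IsIrreducibleMonoid S) {B : H →L[ℂ] H}
    (hc : ∀ A ∈ S, Commute B A) : ∃ c : ℂ, B = c • (1 : H →L[ℂ] H) := by
  have hc' : ∀ A ∈ S, Commute (star B) A := fun A hA => by
    simpa using (hc _ (hS.star_mem A hA)).star_star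
  obtain ⟨c, h1⟩ := hS.exists_eq_smul_one_of_isSelfAdjoint (realPart B).2 fun A hA => by
    rw [realPart_apply_coe]
    exact ((hc A hA).add_left (hc' A hA)).smul_left _
  obtain ⟨d, h2⟩ := hS.exists_eq_smul_one_of_isSelfAdjoint (imaginaryPart B).2 fun A hA => by
    rw [imaginaryPart_apply_coe]
    exact (((hc A hA).sub_left (hc' A hA)).smul_left _).smul_left _
  refine ⟨c + Complex.I * d, ?_⟩
  rw [← realPart_add_I_smul_imaginaryPart B, h1, h2, add_smul, mul_smul]

lemma inner_ampliation_left (A : H →L[ℂ] H) (u v : lp (fun _ : ℕ => H) 2) :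
    ⟪ampliation A u, v⟫_ℂ = ⟪u, ampliation (star A) v⟫_ℂ := by
  simp [lp.inner_eq_tsum, ContinuousLinearMap.star_eq_adjoint,
    ContinuousLinearMap.adjoint_inner_right]

/-- Invariance under both the operator and its adjoint makes `V` reducing: the adjoint keeps the
orthogonal complement invariant. -/
lemma starProjection_ampliation {V : Submodule ℂ (lp (fun _ : ℕ => H) 2)}
    [V.HasOrthogonalProjection] {A : H →L[ℂ] H}
    (hA : ∀ v ∈ V, ampliation A v ∈ V) (hA' : ∀ v ∈ V, ampliation (star A) v ∈ V)
    (v : lp (fun _ : ℕ => H) 2) :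
    V.starProjection (ampliation A v) = ampliation A (V.starProjection v) := by
  refine Submodule.eq_starProjection_of_mem_of_inner_eq_zero
    (hA _ (V.starProjection_apply_mem v)) fun w hw => ?_
  rw [← map_sub, inner_ampliation_left]
  exact V.starProjection_inner_eq_zero v _ (hA' w hw)

/-- A trace-class operator is determined by its trace pairing with an irreducible star-closed
monoid of operators. -/
lemma IsIrreducibleMonoid.eq_zero_of_trace_mul_eq_zero {S : Submonoid (H →L[ℂ] H)}
    (hS : IsIrreducibleMonoid S) {T : H →L[ℂ] H} (hT : IsTraceClass T)
    (h0 : ∀ A ∈ S, trace (A * T) = 0) : T = 0 := by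
  obtain ⟨x, y, hxy⟩ := hT
  -- Balancing the norms of the two factors of each rank-one term turns nuclear summability into
  -- square-summability of `a` and `b` separately, so that both are vectors of `H ⊗ ℓ²`.
  choose a b hab ha hb using fun n => exists_balanced (x n) (y n)
  have hN : IsNuclearSeries a b T := by
    refine ⟨hxy.summable.congr fun n => ?_, by simpa only [hab] using hxy.hasSum⟩
    have : ‖a n‖ = ‖b n‖ := by
      rw [← sq_eq_sq₀ (norm_nonneg _) (norm_nonneg _), ha, hb]
    rw [← ha, sq]
    nth_rw 2 [this]
  let u : lp (fun _ : ℕ => H) 2 := ⟨a, memℓp_gen (by simpa [ha] using hxy.summable)⟩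
  let w : lp (fun _ : ℕ => H) 2 := ⟨b, memℓp_gen (by simpa [hb] using hxy.summable)⟩
  have htr : ∀ A : H →L[ℂ] H, trace (A * T) = ⟪w, ampliation A u⟫_ℂ := fun A => by
    rw [(hN.comp_left A).trace_eq, lp.inner_eq_tsum]
    rfl
  -- The cyclic subspace generated by `u` under `S ⊗ 1`. The hypothesis on `T` says that `w` is
  -- orthogonal to it.
  let V₀ : Submodule ℂ (lp (fun _ : ℕ => H) 2) :=
    Submodule.span ℂ ((fun A => ampliation A u) '' (S : Set (H →L[ℂ] H)))
  let V := V₀.topologicalClosure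
  have hinv₀ : ∀ A ∈ S, V₀ ≤ V₀.comap (ampliation A).toLinearMap := fun A hA => by
    rw [Submodule.span_le]
    rintro _ ⟨B, hB, rfl⟩
    exact Submodule.subset_span ⟨A * B, S.mul_mem hA hB, ampliation_mul A B u⟩
  have hinv : ∀ A ∈ S, ∀ v ∈ V, ampliation A v ∈ V := fun A hA v hv =>
    map_mem_closure (ampliation A).continuous hv fun z hz => hinv₀ A hA hz
  have : CompleteSpace V := V₀.isClosed_topologicalClosure.completeSpace_coe
  have huV : u ∈ V := V₀.le_topologicalClosure
    (Submodule.subset_span ⟨1, S.one_mem, ampliation_one u⟩)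
  -- Each block of the projection commutes with `S`, hence is a scalar by Schur's lemma; an operator
  -- with scalar blocks commutes with `B ⊗ 1` for every bounded `B`.
  have hcomm : ∀ (B : H →L[ℂ] H) (v : lp (fun _ : ℕ => H) 2),
      V.starProjection (ampliation B v) = ampliation B (V.starProjection v) := by
    intro B v
    have hblock : ∀ i j, ∃ c : ℂ, ∀ z : H, V.starProjection (lp.single 2 j z) i = c • z := by
      intro i j
      let Q : H →L[ℂ] H := lp.evalCLM ℂ (fun _ : ℕ => H) 2 i ∘L V.starProjection ∘L
        lp.singleContinuousLinearMap ℂ (fun _ : ℕ => H) 2 j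
      obtain ⟨c, hc⟩ := hS.exists_eq_smul_one (B := Q) fun A hA => by
        ext z
        change V.starProjection (lp.single 2 j (A z)) i = A (V.starProjection (lp.single 2 j z) i)
        rw [← ampliation_single, starProjection_ampliation (hinv A hA)
          (hinv _ (hS.star_mem A hA)), ampliation_apply]
      exact ⟨c, fun z => congrArg (fun R : H →L[ℂ] H => R z) hc⟩
    have hs := lp.hasSum_single (p := 2) (by simp) v
    refine ((hs.mapL (ampliation B)).mapL V.starProjection).unique
      (Eq.subst (motive := fun F => HasSum F _) (funext fun j => ?_)
        ((hs.mapL V.starProjection).mapL (ampliation B)))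
    refine lp.ext (funext fun i => ?_)
    obtain ⟨c, hc⟩ := hblock i j
    rw [ampliation_single, hc, ampliation_apply, hc, map_smul]
  have hwV : ∀ v ∈ V, ⟪w, v⟫_ℂ = 0 := by
    have h1 : V₀ ≤ (innerSL ℂ w).toLinearMap.ker := by
      rw [Submodule.span_le]
      rintro _ ⟨A, hA, rfl⟩
      exact (htr A).symm.trans (h0 A hA)
    exact fun v hv => V₀.topologicalClosure_minimal h1 (ContinuousLinearMap.isClosed_ker _) hv
  have hall : ∀ B : H →L[ℂ] H, trace (B * T) = 0 := fun B => by
    rw [htr]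
    apply hwV
    -- The projection fixes `u` and commutes with `B ⊗ 1`, so it fixes `(B ⊗ 1) u`, which therefore
    -- lies in `V`.
    rw [← Submodule.starProjection_eq_self_iff, hcomm, Submodule.starProjection_eq_self_iff.2 huV]
  ext v
  refine ext_inner_left ℂ fun z => ?_
  rw [← trace_mul_rankOne, trace_mul_comm ⟨x, y, hxy⟩, hall]
  simp

end Irreducible

/-! ### Weyl systems: phases, characteristic functions, eigenvectors -/

section Weyl

open Matrix

variable {ι : Type*} [Fintype ι] [DecidableEq ι] {Δ : Matrix ι ι ℝ}

lemma IsSymplecticMatrix.dotProduct_mulVec_swap (hΔ : IsSymplecticMatrix Δ) (a b : ι → ℝ) :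
    b ⬝ᵥ Δ *ᵥ a = -(a ⬝ᵥ Δ *ᵥ b) := by
  rw [dotProduct_mulVec, ← mulVec_transpose, hΔ.skew, neg_mulVec, neg_dotProduct, dotProduct_comm]

lemma IsSymplecticMatrix.dotProduct_mulVec_self (hΔ : IsSymplecticMatrix Δ) (a : ι → ℝ) :
    a ⬝ᵥ Δ *ᵥ a = 0 := by
  linarith [hΔ.dotProduct_mulVec_swap a a]

lemma IsSymplecticMatrix.eq_zero_of_forall (hΔ : IsSymplecticMatrix Δ) {a : ι → ℝ}
    (h : ∀ b, a ⬝ᵥ Δ *ᵥ b = 0) : a = 0 := by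
  refine eq_zero_of_mulVec_eq_zero hΔ.nondegenerate (dotProduct_eq_zero _ fun b => ?_)
  rw [dotProduct_comm, hΔ.dotProduct_mulVec_swap, h, neg_zero]

lemma eq_zero_of_forall_exp_mul_I_eq_one {r : ℝ}
    (h : ∀ t : ℝ, Complex.exp (-Complex.I * ((t * r : ℝ) : ℂ)) = 1) : r = 0 := by
  by_contra hr
  -- At this `t` the exponential equals `exp (-iπ) = -1`.
  have h1 := h (r⁻¹ * Real.pi)
  rw [mul_assoc, mul_comm Real.pi, ← mul_assoc, inv_mul_cancel₀ hr, one_mul, neg_mul,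
    mul_comm, Complex.exp_neg, Complex.exp_pi_mul_I] at h1
  norm_num at h1

variable {H : Type*} [NormedAddCommGroup H] [InnerProductSpace ℂ H] [CompleteSpace H]
  {W : (ι → ℝ) → H →L[ℂ] H}

namespace IsIrreducibleWeylSystem

lemma star_mul_self (hW : IsIrreducibleWeylSystem Δ W) (z : ι → ℝ) : star (W z) * W z = 1 :=
  Unitary.star_mul_self_of_mem (hW.unitary z)

lemma map_zero (hW : IsIrreducibleWeylSystem Δ W) : W 0 = 1 := by
  have h := hW.ccr 0 0
  simp only [zero_dotProduct, Complex.ofReal_zero, mul_zero, Complex.exp_zero, one_smul,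
    add_zero] at h
  calc W 0 = star (W 0) * W 0 * W 0 := by rw [hW.star_mul_self, one_mul]
    _ = star (W 0) * W 0 := by rw [mul_assoc, h]
    _ = 1 := hW.star_mul_self 0

lemma ne_zero (hW : IsIrreducibleWeylSystem Δ W) (z : ι → ℝ) : W z ≠ 0 := fun h => by
  have := hW.nontrivial
  simpa [h] using hW.star_mul_self z

lemma star_eq (hΔ : IsSymplecticMatrix Δ) (hW : IsIrreducibleWeylSystem Δ W) (z : ι → ℝ) :
    star (W z) = W (-z) := by
  have h : W z * W (-z) = 1 := by
    rw [hW.ccr, mulVec_neg, dotProduct_neg, hΔ.dotProduct_mulVec_self]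
    simp [hW.map_zero]
  calc star (W z) = star (W z) * (W z * W (-z)) := by rw [h, mul_one]
    _ = W (-z) := by rw [← mul_assoc, hW.star_mul_self, one_mul]

lemma mul_comm_phase (hΔ : IsSymplecticMatrix Δ) (hW : IsIrreducibleWeylSystem Δ W)
    (a b : ι → ℝ) :
    W a * W b = Complex.exp (-Complex.I * ((a ⬝ᵥ Δ *ᵥ b : ℝ) : ℂ)) • (W b * W a) := by
  rw [hW.ccr, hW.ccr, smul_smul, ← Complex.exp_add, add_comm b a, hΔ.dotProduct_mulVec_swap a b]
  congr 2
  push_cast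
  ring

lemma phase_eq_one_of_commute (hΔ : IsSymplecticMatrix Δ) (hW : IsIrreducibleWeylSystem Δ W)
    {a b : ι → ℝ} (h : Commute (W a) (W b)) :
    Complex.exp (-Complex.I * ((a ⬝ᵥ Δ *ᵥ b : ℝ) : ℂ)) = 1 := by
  have h1 := hW.mul_comm_phase hΔ a b
  rw [h.eq, hW.ccr b a] at h1
  have hne : Complex.exp (-(Complex.I / 2) * ((b ⬝ᵥ Δ *ᵥ a : ℝ) : ℂ)) • W (a + b) ≠ 0 :=
    smul_ne_zero (Complex.exp_ne_zero _) (hW.ne_zero _)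
  exact (smul_left_injective ℂ hne (by simpa using h1)).symm

/-- Weyl operators and their scalar multiples. -/
def monoid (hW : IsIrreducibleWeylSystem Δ W) :
    Submonoid (H →L[ℂ] H) where
  carrier := {A | ∃ (c : ℂ) (z : ι → ℝ), A = c • W z}
  one_mem' := ⟨1, 0, by rw [hW.map_zero, one_smul]⟩
  mul_mem' := by
    rintro _ _ ⟨c, z, rfl⟩ ⟨d, w, rfl⟩
    exact ⟨_, w + z, by rw [smul_mul_smul_comm, hW.ccr, smul_smul]⟩

/-- Scalar multiples absorb the phases of the commutation relations, and `W(z)^* = W(-z)` gives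
star-closedness. -/
lemma isIrreducibleMonoid (hΔ : IsSymplecticMatrix Δ) (hW : IsIrreducibleWeylSystem Δ W) :
    IsIrreducibleMonoid hW.monoid where
  star_mem := by
    rintro _ ⟨c, z, rfl⟩
    exact ⟨star c, -z, by rw [star_smul, hW.star_eq hΔ]⟩
  irreducible L hL h := hW.irreducible L hL fun z ψ hψ => h _ ⟨1, z, (one_smul _ _).symm⟩ ψ hψ

/-- The quantum characteristic function determines a trace-class operator. -/
lemma eq_zero_of_trace_mul_eq_zero (hΔ : IsSymplecticMatrix Δ) (hW : IsIrreducibleWeylSystem Δ W)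
    {T : H →L[ℂ] H} (hT : IsTraceClass T) (h : ∀ z, trace (W z * T) = 0) : T = 0 := by
  refine (hW.isIrreducibleMonoid hΔ).eq_zero_of_trace_mul_eq_zero hT ?_
  rintro _ ⟨c, z, rfl⟩
  rw [smul_mul_assoc, trace_smul, h, mul_zero]

/-- The matrix elements form the characteristic function of `|v⟩⟨u|`, whose norm is the product of
the norms of `u` and `v`. -/
lemma eq_zero_of_forall_inner_eq_zero (hΔ : IsSymplecticMatrix Δ)
    (hW : IsIrreducibleWeylSystem Δ W) {u v : H} (h : ∀ z, ⟪u, W z v⟫_ℂ = 0) :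
    u = 0 ∨ v = 0 := by
  have h1 : rankOne ℂ v u = 0 :=
    hW.eq_zero_of_trace_mul_eq_zero hΔ (isTraceClass_rankOne v u) fun z => by
      rw [trace_mul_rankOne, h]
  rw [← norm_eq_zero, InnerProductSpace.norm_rankOne, mul_eq_zero, norm_eq_zero, norm_eq_zero] at h1
  exact h1.symm

/-- The Weyl operators along a nonzero direction have no common eigenvector. -/
lemma eq_zero_of_eigenvector (hΔ : IsSymplecticMatrix Δ) (hW : IsIrreducibleWeylSystem Δ W)
    {a : ι → ℝ} {v : H} (hv : v ≠ 0) (h : ∀ t : ℝ, ∃ c : ℂ, W (t • a) v = c • v) : a = 0 := by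
  by_contra ha
  obtain ⟨b, hb⟩ : ∃ b, a ⬝ᵥ Δ *ᵥ b ≠ 0 := by
    by_contra! hb
    exact ha (hΔ.eq_zero_of_forall hb)
  -- Conjugation by `W (t • a)` multiplies `W (s • b)` by a phase depending on `t`, but leaves its
  -- expectation in the eigenvector `v` unchanged, since the eigenvalue has modulus 1. A nonzero
  -- expectation would force the phase to be 1 for all `t`.
  have horth : ∀ s : ℝ, s ≠ 0 → ⟪v, W (s • b) v⟫_ℂ = 0 := by
    intro s hs
    by_contra hne
    refine mul_ne_zero hs hb (eq_zero_of_forall_exp_mul_I_eq_one fun t => ?_)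
    obtain ⟨c, hc⟩ := h t
    have hu := hW.star_mul_self (t • a)
    have hcomm := congrArg (fun T : H →L[ℂ] H => ⟪W (t • a) v, T v⟫_ℂ)
      (hW.mul_comm_phase hΔ (t • a) (s • b))
    have hiso : ∀ x y : H, ⟪W (t • a) x, W (t • a) y⟫_ℂ = ⟪x, y⟫_ℂ := fun x y => by
      rw [← ContinuousLinearMap.adjoint_inner_right, ← ContinuousLinearMap.star_eq_adjoint,
        ← mul_apply_eq_comp, hu, one_apply_eq_self]
    have hcc : star c * c = 1 := by
      have h2 := hiso v v
      rw [hc, inner_smul_left, inner_smul_right, ← mul_assoc] at h2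
      exact mul_right_cancel₀ (inner_self_ne_zero.2 hv) (h2.trans (one_mul _).symm)
    simp only [_root_.smul_apply, mul_apply_eq_comp, inner_smul_right] at hcomm
    rw [hiso, hc, _root_.map_smul, inner_smul_left, inner_smul_right, ← mul_assoc _ c] at hcomm
    rw [show (starRingEnd ℂ) c = star c from rfl, hcc, one_mul, smul_dotProduct, mulVec_smul,
      dotProduct_smul, smul_eq_mul, smul_eq_mul] at hcomm
    exact (mul_right_cancel₀ hne ((one_mul _).trans hcomm)).symm
  have hcont : Continuous fun s : ℝ => ⟪v, W (s • b) v⟫_ℂ :=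
    continuous_const.inner ((hW.continuous v).comp (by fun_prop))
  -- Strong continuity extends the vanishing to `s = 0`, where the expectation is `⟪v, v⟫`.
  have hdense : (fun s : ℝ => ⟪v, W (s • b) v⟫_ℂ) = fun _ => 0 :=
    hcont.ext_on (dense_compl_singleton (0 : ℝ)) continuous_const fun s hs => horth s hs
  have := congrFun hdense 0
  simp only [zero_smul, hW.map_zero, one_apply_eq_self] at this
  exact hv (inner_self_eq_zero.1 this)

end IsIrreducibleWeylSystem

end Weyl

/-! ### Matrix elements of dual channels and completely depolarizing channels -/

section Dual

variable {H K : Type*} [NormedAddCommGroup H] [InnerProductSpace ℂ H] [CompleteSpace H]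
  [NormedAddCommGroup K] [InnerProductSpace ℂ K] [CompleteSpace K]

namespace Channel

lemma inner_dual (Φ : Channel H K) (A : K →L[ℂ] K) (x y : H) :
    ⟪y, Φ.dual A x⟫_ℂ =
      trace (A * (Φ.toLin ⟨rankOne ℂ x y, isTraceClass_rankOne x y⟩ : K →L[ℂ] K)) := by
  rw [trace_dual_mul, trace_mul_rankOne]

/-- The dual of a subchannel is the compression of `Φ.dual` to `L`, because extending a rank-one
operator on `L` by zero gives the rank-one operator of the same vectors. -/
lemma inner_dual_subchannel (Φ : Channel H K) (L : Submodule ℂ H) [CompleteSpace L]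
    (A : K →L[ℂ] K) (x y : L) : ⟪y, (Φ.subchannel L).dual A x⟫_ℂ = ⟪(y : H), Φ.dual A x⟫_ℂ := by
  rw [inner_dual, inner_dual]
  have h : extendTraceClass L ⟨rankOne ℂ x y, isTraceClass_rankOne x y⟩ =
      ⟨rankOne ℂ (x : H) (y : H), isTraceClass_rankOne _ _⟩ := by
    refine Subtype.ext ?_
    change L.subtypeL ∘L rankOne ℂ x y ∘L L.subtypeL.adjoint = rankOne ℂ (x : H) (y : H)
    rw [InnerProductSpace.rankOne_comp, InnerProductSpace.comp_rankOne]
    simp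
  rw [← h]
  rfl
lemma IsCompletelyDepolarizing.exists_dual_eq_smul_one {Φ : Channel H K}
    (h : Φ.IsCompletelyDepolarizing) (A : K →L[ℂ] K) :
    ∃ c : ℂ, Φ.dual A = c • (1 : H →L[ℂ] H) := by
  obtain ⟨σ, -, -, h⟩ := h
  refine ⟨trace (A * (σ : K →L[ℂ] K)), ?_⟩
  ext x
  refine ext_inner_left ℂ fun y => ?_
  rw [inner_dual, h, trace_rankOne, Submodule.coe_smul, mul_smul_comm, trace_smul]
  simp [inner_smul_right, mul_comm]

lemma IsCompletelyDepolarizing.isDiscreteClassicalQuantum {Φ : Channel H K}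
    (h : Φ.IsCompletelyDepolarizing) : Φ.IsDiscreteClassicalQuantum := by
  refine ⟨fun A B => ?_, ?_⟩
  · obtain ⟨c, hc⟩ := h.exists_dual_eq_smul_one A
    rw [hc]
    exact (Commute.one_left _).smul_left c
  · obtain ⟨s, e, -⟩ := exists_hilbertBasis ℂ H
    refine ⟨s, e, fun A i => ?_⟩
    obtain ⟨c, hc⟩ := h.exists_dual_eq_smul_one A
    exact ⟨c, by simp [hc]⟩

end Channel

end Dual

/-! ### Gaussian channels -/

section Gaussian

open Matrix

variable {ι κ : Type*} [Fintype ι] [DecidableEq ι] [Fintype κ] [DecidableEq κ]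
  {H K : Type*} [NormedAddCommGroup H] [InnerProductSpace ℂ H] [CompleteSpace H]
  [NormedAddCommGroup K] [InnerProductSpace ℂ K] [CompleteSpace K]
  {ΔA : Matrix ι ι ℝ} {ΔB : Matrix κ κ ℝ} {WA : (ι → ℝ) → H →L[ℂ] H} {WB : (κ → ℝ) → K →L[ℂ] K}
  {M : Matrix ι κ ℝ} {l : κ → ℝ} {α : Matrix κ κ ℝ} {Φ : Channel H K}

namespace Channel

/-- The commutant of the image of the dual channel is detected by the Weyl operators. -/
lemma commute_dual_of_weyl (hΔB : IsSymplecticMatrix ΔB) (hWB : IsIrreducibleWeylSystem ΔB WB)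
    {X : H →L[ℂ] H} (h : ∀ z, Commute (Φ.dual (WB z)) X) (A : K →L[ℂ] K) :
    Commute (Φ.dual A) X := by
  refine ContinuousLinearMap.ext fun x => ext_inner_left ℂ fun y => ?_
  -- Chosen so that pairing `Φ[ρ]` with `B` gives the matrix element of the commutator of `Φ.dual B`
  -- with `X`. It vanishes on Weyl operators, so `Φ[ρ] = 0`.
  let ρ : TraceClass H := ⟨rankOne ℂ (X x) y, isTraceClass_rankOne _ _⟩ -
    ⟨rankOne ℂ x (X.adjoint y), isTraceClass_rankOne _ _⟩
  have hρ : ∀ B : K →L[ℂ] K, trace (B * (Φ.toLin ρ : K →L[ℂ] K)) =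
      ⟪y, (Φ.dual B * X) x⟫_ℂ - ⟪y, (X * Φ.dual B) x⟫_ℂ := fun B => by
    rw [trace_dual_mul, Submodule.coe_sub, mul_sub, sub_eq_add_neg, ← neg_one_smul ℂ (_ * _),
      trace_add (isTraceClass_mul_left (isTraceClass_rankOne _ _) _)
        ((TraceClass H).smul_mem _ (isTraceClass_mul_left (isTraceClass_rankOne _ _) _)),
      trace_smul, trace_mul_rankOne, trace_mul_rankOne, ContinuousLinearMap.adjoint_inner_left]
    simp [sub_eq_add_neg]
  have h0 : (Φ.toLin ρ : K →L[ℂ] K) = 0 :=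
    hWB.eq_zero_of_trace_mul_eq_zero hΔB (Φ.toLin ρ).2 fun z => by
      rw [hρ, (h z).eq, sub_self]
  rw [← sub_eq_zero, ← hρ, h0, mul_zero]
  simp [trace]

end Channel

namespace IsGaussianChannel

lemma exists_dual_weyl (hΦ : IsGaussianChannel ΔA ΔB WA WB M l α Φ) (z : κ → ℝ) :
    ∃ c : ℂ, c ≠ 0 ∧ Φ.dual (WB z) = c • WA (M *ᵥ z) :=
  ⟨_, Complex.exp_ne_zero _, hΦ.dual_weyl z⟩

lemma isClassicalQuantum_iff (hΔA : IsSymplecticMatrix ΔA) (hΔB : IsSymplecticMatrix ΔB)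
    (hWA : IsIrreducibleWeylSystem ΔA WA) (hWB : IsIrreducibleWeylSystem ΔB WB)
    (hΦ : IsGaussianChannel ΔA ΔB WA WB M l α Φ) :
    Φ.IsClassicalQuantum ↔ Mᵀ * ΔA * M = 0 := by
  have hform : ∀ z w : κ → ℝ, (M *ᵥ z) ⬝ᵥ ΔA *ᵥ (M *ᵥ w) = z ⬝ᵥ (Mᵀ * ΔA * M) *ᵥ w := fun z w => by
    rw [← mulVec_mulVec, ← mulVec_mulVec, dotProduct_mulVec z, vecMul_transpose]
  constructor
  · intro h
    refine ext_of_mulVec_single fun j => ?_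
    rw [zero_mulVec]
    refine dotProduct_eq_zero _ fun z => ?_
    rw [dotProduct_comm, ← hform]
    -- One commuting pair fixes the form only modulo `2π`; scaling `z` by an arbitrary `t` removes
    -- the ambiguity.
    refine eq_zero_of_forall_exp_mul_I_eq_one fun t => ?_
    rw [← smul_eq_mul t, ← smul_dotProduct, ← mulVec_smul]
    refine hWA.phase_eq_one_of_commute hΔA ?_
    obtain ⟨c, hc0, hc⟩ := hΦ.exists_dual_weyl (t • z)
    obtain ⟨d, hd0, hd⟩ := hΦ.exists_dual_weyl (Pi.single j 1)
    have hcd := h (WB (t • z)) (WB (Pi.single j 1))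
    rw [hc, hd] at hcd
    simpa [smul_smul, hc0, hd0] using (hcd.smul_left c⁻¹).smul_right d⁻¹
  · intro h
    have hcomm : ∀ z w, Commute (Φ.dual (WB z)) (Φ.dual (WB w)) := fun z w => by
      obtain ⟨c, -, hc⟩ := hΦ.exists_dual_weyl z
      obtain ⟨d, -, hd⟩ := hΦ.exists_dual_weyl w
      rw [hc, hd]
      refine (Commute.smul_left ?_ c).smul_right d
      have := hWA.mul_comm_phase hΔA (M *ᵥ z) (M *ᵥ w)
      rwa [hform, h, zero_mulVec, dotProduct_zero, Complex.ofReal_zero, mul_zero, Complex.exp_zero,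
        one_smul] at this
    intro A B
    -- Commutation is extended from Weyl operators to bounded operators in one argument at a time.
    refine Channel.commute_dual_of_weyl hΔB hWB (fun z => ?_) A
    exact (Channel.commute_dual_of_weyl hΔB hWB (fun w => hcomm w z) B).symm

/-- Any vector of the diagonalizing basis is an eigenvector of `WA` along the whole line through
each column of `M`, so each column vanishes. -/
lemma eq_zero_of_isDiscreteClassicalQuantum (hΔA : IsSymplecticMatrix ΔA)
    (hWA : IsIrreducibleWeylSystem ΔA WA) (hΦ : IsGaussianChannel ΔA ΔB WA WB M l α Φ)
    (h : Φ.IsDiscreteClassicalQuantum) : M = 0 := by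
  obtain ⟨-, s, e, he⟩ := h
  have hs : Nonempty s := by
    by_contra hs
    rw [not_nonempty_iff] at hs
    have := hWA.nontrivial
    obtain ⟨v, hv⟩ := exists_ne (0 : H)
    exact hv ((e.hasSum_repr v).unique (by simp))
  obtain ⟨i⟩ := hs
  refine ext_of_mulVec_single fun j => ?_
  rw [zero_mulVec]
  refine hWA.eq_zero_of_eigenvector hΔA (e.orthonormal.ne_zero i) fun t => ?_
  obtain ⟨c, hc0, hc⟩ := hΦ.exists_dual_weyl (t • Pi.single j 1)
  obtain ⟨d, hd⟩ := he (WB (t • Pi.single j 1)) i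
  refine ⟨c⁻¹ * d, ?_⟩
  rw [← mulVec_smul, mul_smul, ← hd, hc, _root_.smul_apply, inv_smul_smul₀ hc0]

/-- The dual maps Weyl operators to scalars, so a traceless input has an output with zero
characteristic function. The fixed state is the image of any pure state `|e⟩⟨e|`. -/
lemma isCompletelyDepolarizing (hΔB : IsSymplecticMatrix ΔB)
    (hWA : IsIrreducibleWeylSystem ΔA WA) (hWB : IsIrreducibleWeylSystem ΔB WB)
    (hΦ : IsGaussianChannel ΔA ΔB WA WB 0 l α Φ) : Φ.IsCompletelyDepolarizing := by
  have := hWA.nontrivial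
  obtain ⟨e, he⟩ := exists_norm_eq H zero_le_one
  let ρ₀ : TraceClass H := ⟨rankOne ℂ e e, isTraceClass_rankOne e e⟩
  have htr₀ : trace (ρ₀ : H →L[ℂ] H) = 1 := by
    rw [trace_rankOne, inner_self_eq_norm_sq_to_K, he]
    simp
  have hzero : ∀ ρ : TraceClass H, trace (ρ : H →L[ℂ] H) = 0 → Φ.toLin ρ = 0 := fun ρ hρ => by
    refine Subtype.ext (hWB.eq_zero_of_trace_mul_eq_zero hΔB (Φ.toLin ρ).2 fun z => ?_)
    obtain ⟨c, -, hc⟩ := hΦ.exists_dual_weyl z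
    rw [Φ.trace_dual_mul, hc, zero_mulVec, hWA.map_zero, smul_mul_assoc, trace_smul, one_mul, hρ,
      mul_zero]
  refine ⟨Φ.toLin ρ₀, Φ.isPositive_toLin ?_, (Φ.tracePreserving ρ₀).trans htr₀, fun ρ => ?_⟩
  · refine isPositive_of_inner_nonneg fun v => ?_
    change 0 ≤ ⟪v, rankOne ℂ e e v⟫_ℂ
    rw [InnerProductSpace.rankOne_apply, inner_smul_right, ← inner_conj_symm v e, mul_comm,
      ← Complex.star_def]
    exact star_mul_self_nonneg _
  · rw [← sub_eq_zero, ← _root_.map_smul, ← _root_.map_sub]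
    refine hzero _ ?_
    rw [sub_eq_add_neg, ← neg_one_smul ℂ (_ • _), smul_smul, Submodule.coe_add, Submodule.coe_smul,
      trace_add ρ.2 ((TraceClass H).smul_mem _ ρ₀.2), trace_smul, htr₀]
    ring

lemma eq_zero_of_isCompletelyDepolarizing (hΔA : IsSymplecticMatrix ΔA)
    (hWA : IsIrreducibleWeylSystem ΔA WA) (hΦ : IsGaussianChannel ΔA ΔB WA WB M l α Φ)
    (h : Φ.IsCompletelyDepolarizing) : M = 0 :=
  hΦ.eq_zero_of_isDiscreteClassicalQuantum hΔA hWA h.isDiscreteClassicalQuantum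

/-- Diagonality kills the matrix elements of `Φ.dual (WB z)` between two distinct basis vectors of
`L`. As `M` is onto, these are all the Weyl matrix elements up to nonzero factors, which
irreducibility excludes. -/
lemma not_isDiscreteClassicalQuantum_subchannel (hΔA : IsSymplecticMatrix ΔA)
    (hWA : IsIrreducibleWeylSystem ΔA WA) (hΦ : IsGaussianChannel ΔA ΔB WA WB M l α Φ)
    (hM : M.rank = Fintype.card ι) (L : Submodule ℂ H) [CompleteSpace L]
    (hL : 1 < Module.rank ℂ L) : ¬ (Φ.subchannel L).IsDiscreteClassicalQuantum := by
  rintro ⟨-, s, e, he⟩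
  have hsurj : Function.Surjective M.mulVec := by
    have : LinearMap.range M.mulVecLin = ⊤ := by
      apply Submodule.eq_top_of_finrank_eq
      rw [Module.finrank_fintype_fun_eq_card]
      exact hM
    exact LinearMap.range_eq_top.1 this
  -- With at most one basis vector, `L` would have dimension at most 1.
  have hs : Nontrivial s := by
    by_contra hs
    rw [not_nontrivial_iff_subsingleton] at hs
    refine hL.not_ge (rank_le_one_iff.2 ?_)
    rcases isEmpty_or_nonempty s with hs' | ⟨⟨i⟩⟩
    · exact ⟨0, fun v => ⟨0, hasSum_empty.unique (e.hasSum_repr v) ▸ smul_zero 0⟩⟩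
    · have := uniqueOfSubsingleton i
      exact ⟨e default, fun v => ⟨e.repr v default, (hasSum_unique _).unique (e.hasSum_repr v)⟩⟩
  obtain ⟨i, j, hij⟩ := hs
  have horth : ∀ w, ⟪(e i : H), WA w (e j)⟫_ℂ = 0 := fun w => by
    obtain ⟨z, rfl⟩ := hsurj w
    obtain ⟨c, hc0, hc⟩ := hΦ.exists_dual_weyl z
    obtain ⟨d, hd⟩ := he (WB z) j
    have h1 := Φ.inner_dual_subchannel L (WB z) (e j) (e i)
    rw [hd, inner_smul_right, e.orthonormal.2 hij, mul_zero, hc, _root_.smul_apply,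
      inner_smul_right] at h1
    exact (mul_eq_zero.1 h1.symm).resolve_left hc0
  rcases hWA.eq_zero_of_forall_inner_eq_zero hΔA horth with h | h
  · exact e.orthonormal.ne_zero i (Subtype.ext h)
  · exact e.orthonormal.ne_zero j (Subtype.ext h)

end IsGaussianChannel

end Gaussian

end

end QChannel

theorem proposition5 {ι κ : Type*} [Fintype ι] [DecidableEq ι] [Fintype κ] [DecidableEq κ]
    {HA HB : Type*}
    [NormedAddCommGroup HA] [InnerProductSpace ℂ HA] [CompleteSpace HA]
    [NormedAddCommGroup HB] [InnerProductSpace ℂ HB] [CompleteSpace HB]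
    (ΔA : Matrix ι ι ℝ) (ΔB : Matrix κ κ ℝ)
    (hΔA : QChannel.IsSymplecticMatrix ΔA) (hΔB : QChannel.IsSymplecticMatrix ΔB)
    (WA : (ι → ℝ) → HA →L[ℂ] HA) (WB : (κ → ℝ) → HB →L[ℂ] HB)
    (hWA : QChannel.IsIrreducibleWeylSystem ΔA WA)
    (hWB : QChannel.IsIrreducibleWeylSystem ΔB WB)
    (M : Matrix ι κ ℝ) (l : κ → ℝ) (α : Matrix κ κ ℝ)
    (Φ : QChannel.Channel HA HB)
    (hΦ : QChannel.IsGaussianChannel ΔA ΔB WA WB M l α Φ) :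
    (Φ.IsClassicalQuantum ↔ M.transpose * ΔA * M = 0) ∧
    (Φ.IsDiscreteClassicalQuantum ↔ M = 0) ∧
    (M = 0 ↔ Φ.IsCompletelyDepolarizing) ∧
    (M.rank = Fintype.card ι →
      ∀ (L : Submodule ℂ HA) [CompleteSpace L], 1 < Module.rank ℂ L →
        ¬ (Φ.subchannel L).IsDiscreteClassicalQuantum) := by
  have hdep : M = 0 → Φ.IsCompletelyDepolarizing := by
    rintro rfl
    exact hΦ.isCompletelyDepolarizing hΔB hWA hWB
  exact ⟨hΦ.isClassicalQuantum_iff hΔA hΔB hWA hWB,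
    ⟨hΦ.eq_zero_of_isDiscreteClassicalQuantum hΔA hWA,
      fun h => (hdep h).isDiscreteClassicalQuantum⟩,
    ⟨hdep, hΦ.eq_zero_of_isCompletelyDepolarizing hΔA hWA⟩,
    fun hM L _ hL => hΦ.not_isDiscreteClassicalQuantum_subchannel hΔA hWA hM L hL⟩
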